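/- Let $R$ be a discrete valuation ring with field of fractions $K$, maximal ideal $\mathfrak m$ and perfect residue field $\kappa=R/\mathfrak m$. For an integral regular scheme $X$ that is proper over $R$ and has non-empty generic fibre $X_K$, let $\Sigma_X$ be the set of irreducible components $C$ of multiplicity $1$ of the special fibre $X_\kappa$ (that is, those for which $\mathfrak m$ generates the maximal ideal of the local ring of $X$ at the generic point of $C$). For $C\in\Sigma_X$ let $\kappa_C$ be the algebraic closure of $\kappa$ in the function field $\kappa(C)$. Order $\Sigma_X$ by letting $D\le C$ if there is a $\kappa$-embedding $\kappa_D\hookrightarrow\kappa_C$; call $C\in\Sigma_X$ minimal if every $D\in\Sigma_X$ with $D\le C$ satisfies $C\le D$. If $C\in\Sigma_X$ is minimal, then $\kappa_C$ is a finite extension of $\kappa$. The set of $\kappa$-isomorphism classes of the extensions $\kappa\subset\kappa_C$, where $C$ runs through the minimal elements of $\Sigma_X$, is a birational invariant of $X_K$: if $Y$ is another integral regular scheme that is proper over $R$ and has non-empty generic fibre, and $X_K$ and $Y_K$ are birationally equivalent over $K$ (they have $K$-isomorphic dense open subschemes), then the sets attached to $X$ and to $Y$ coincide. -/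

import Mathlib

open CategoryTheory CategoryTheory.Limits AlgebraicGeometry

universe u

/-- A scheme is regular if it is locally Noetherian and all its local rings are regular. -/
class IsRegularScheme (X : Scheme.{u}) : Prop where
  isLocallyNoetherian : IsLocallyNoetherian X
  isRegularLocalRing_stalk : ∀ x : X, IsRegularLocalRing (X.presheaf.stalk x)

namespace DVRScheme

noncomputable section

section GenericFibre

variable {R : Type u} [CommRing R] {X : Scheme.{u}} (f : X ⟶ Spec (.of R))
  (K : Type u) [Field K] [Algebra R K]

/-- The fibre `X_K = X ×_R K` (used when `K` is the field of fractions of `R`). -/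
abbrev genericFibre : Scheme.{u} :=
  pullback f (Spec.map (CommRingCat.ofHom (algebraMap R K)))

/-- The structure morphism `X_K ⟶ Spec K`. -/
abbrev genericFibreHom : genericFibre f K ⟶ Spec (.of K) :=
  pullback.snd f (Spec.map (CommRingCat.ofHom (algebraMap R K)))

end GenericFibre

section SpecialFibre

variable {R : Type u} [CommRing R] [IsLocalRing R] {X : Scheme.{u}} (f : X ⟶ Spec (.of R))

/-- The special fibre `X_κ = X ×_R κ`, where `κ` is the residue field of `R`. -/
abbrev specialFibre : Scheme.{u} :=
  pullback f (Spec.map (CommRingCat.ofHom (IsLocalRing.residue R)))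

/-- The closed immersion `X_κ ⟶ X`. -/
abbrev specialFibreι : specialFibre f ⟶ X :=
  pullback.fst f (Spec.map (CommRingCat.ofHom (IsLocalRing.residue R)))

/-- The structure morphism `X_κ ⟶ Spec κ`. -/
abbrev specialFibreHom : specialFibre f ⟶ Spec (.of (IsLocalRing.ResidueField R)) :=
  pullback.snd f (Spec.map (CommRingCat.ofHom (IsLocalRing.residue R)))

/-- The ring homomorphism `R → 𝒪_{X,x}` given by the structure morphism `X ⟶ Spec R`. -/
def toStalk (x : X) : R →+* X.presheaf.stalk x :=
  ((Scheme.ΓSpecIso (.of R)).inv ≫ f.appTop ≫ X.presheaf.germ ⊤ x trivial).hom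

/-- The generic point, in `X_κ`, of an irreducible component of `X_κ`. -/
def componentPoint (C : irreducibleComponents (specialFibre f)) : specialFibre f :=
  IsIrreducible.genericPoint (S := (C : Set (specialFibre f))) C.2.1

/-- The local ring `𝒪_C` of `X` at the generic point of an irreducible component `C` of `X_κ`. -/
abbrev componentLocalRing (C : irreducibleComponents (specialFibre f)) : CommRingCat.{u} :=
  X.presheaf.stalk (specialFibreι f (componentPoint f C))

/-- The multiplicity of an irreducible component `C` of `X_κ`: the length of the local ring
`𝒪_C / 𝔪 𝒪_C` of `X_κ` at the generic point of `C`, where `𝔪` is the maximal ideal of `R`.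
It is `1` if and only if `𝔪 𝒪_C` is the maximal ideal of `𝒪_C`. -/
def componentMultiplicity (C : irreducibleComponents (specialFibre f)) : ℕ∞ :=
  Module.length (componentLocalRing f C)
    (componentLocalRing f C ⧸
      (IsLocalRing.maximalIdeal R).map (toStalk f (specialFibreι f (componentPoint f C))))

/-- The function field `κ(C)` of an irreducible component `C` of `X_κ` (with its reduced
structure), i.e. the residue field of `X_κ` at the generic point of `C`. -/
def componentFunctionField (C : irreducibleComponents (specialFibre f)) : Type u :=
  (specialFibre f).residueField (componentPoint f C)

instance (C : irreducibleComponents (specialFibre f)) : Field (componentFunctionField f C) :=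
  inferInstanceAs (Field ((specialFibre f).residueField (componentPoint f C)))

/-- `κ(C)` is an extension of `κ` through the structure morphism `X_κ ⟶ Spec κ`. -/
instance (C : irreducibleComponents (specialFibre f)) :
    Algebra (IsLocalRing.ResidueField R) (componentFunctionField f C) :=
  RingHom.toAlgebra
    ((Scheme.ΓSpecIso (.of (IsLocalRing.ResidueField R))).inv ≫ (specialFibreHom f).appTop ≫
      (specialFibre f).Γevaluation (componentPoint f C)).hom

/-- The set `Σ_X` of irreducible components of multiplicity `1` of `X_κ`. -/
structure MultOneComponent where
  component : irreducibleComponents (specialFibre f)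
  multiplicity_eq_one : componentMultiplicity f component = 1

variable {f} in
/-- The field `κ_C`: the algebraic closure of `κ` in the function field `κ(C)`. -/
abbrev MultOneComponent.constantField (C : MultOneComponent f) :
    IntermediateField (IsLocalRing.ResidueField R) (componentFunctionField f C.component) :=
  algebraicClosure (IsLocalRing.ResidueField R) (componentFunctionField f C.component)

/-- The ordering of `Σ_X`: `D ≤ C` if `κ_D ⊂ κ_C`, that is, if there is an embedding of
extensions of `κ` of `κ_D` into `κ_C`. -/
instance : Preorder (MultOneComponent f) where
  le D C := Nonempty (D.constantField →ₐ[IsLocalRing.ResidueField R] C.constantField)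
  le_refl C := ⟨AlgHom.id _ _⟩
  le_trans _ _ _ := fun ⟨g⟩ ⟨h⟩ => ⟨h.comp g⟩

/-- The set of (isomorphism classes of) extensions `κ ⊂ κ_C`, where `C` runs through the minimal
elements of `Σ_X`. -/
def minimalExtensions :
    Set (Quotient (isIsomorphicSetoid (CommAlgCat.{u} (IsLocalRing.ResidueField R)))) :=
  {E | ∃ C : MultOneComponent f, IsMin C ∧
    E = Quotient.mk _ (CommAlgCat.of (IsLocalRing.ResidueField R) C.constantField)}

end SpecialFibre

end

end DVRScheme

/-! For `C` in `Σ_X` the local ring `𝒪_{X,C}` is a discrete valuation ring with uniformizer `ϖ`, a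
uniformizer of `R`. The birational map and properness of `Y` give `Spec 𝒪_{X,C} ⟶ Y`, with closed
point going to some `y`. As `ϖ` maps to a uniformizer under the local map `𝒪_{Y,y} → 𝒪_{X,C}`, it is
not in `𝔪_y²`. So `𝒪_{Y,y}/ϖ` is regular, hence a domain, and `(ϖ)` is the generic point of a
multiplicity-one component `D` through `y`.

The field `κ_D` embeds in the fraction field of `𝒪_{Y,y}/ϖ`. Cutting this regular ring down by one
parameter at a time moves the embedding to the residue field at `y`, hence to `κ(C)` and so to `κ_C`
(`IsRegularLocalRing.exists_algHom_of_isFractionRing`). Thus every `C` in `Σ_X` dominates some `D`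
in `Σ_Y`, and conversely; the rest is order theory. Finiteness holds because subextensions of a
finitely generated field extension are finitely generated. -/

open IsLocalRing

/-! ### Regular local rings and their quotients by a parameter -/

namespace IsRegularLocalRing

/-- Expand `t` in a minimal generating set. Since `t` is not in the square, some coefficient is a
unit, and that generator becomes redundant modulo `t`. -/
theorem spanFinrank_maximalIdeal_quotient_lt {A : Type*} [CommRing A] [IsLocalRing A]
    [IsNoetherianRing A] {t : A} (ht : t ∈ maximalIdeal A) (ht' : t ∉ maximalIdeal A ^ 2)
    [IsLocalRing (A ⧸ Ideal.span {t})] :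
    (maximalIdeal (A ⧸ Ideal.span {t})).spanFinrank < (maximalIdeal A).spanFinrank := by
  classical
  obtain ⟨s, hs, hspan⟩ := Submodule.FG.exists_span_finset_card_eq_spanFinrank
    (maximalIdeal A).fg_of_isNoetherianRing
  have hsm : ∀ i ∈ s, i ∈ maximalIdeal A := fun i hi => hspan ▸ Submodule.subset_span hi
  obtain ⟨a, -, ha⟩ := Submodule.mem_span_finset.1 (hspan ▸ ht : t ∈ Submodule.span A (s : Set A))
  obtain ⟨j, hj, haj⟩ : ∃ j ∈ s, IsUnit (a j) := by
    by_contra! h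
    refine ht' (ha ▸ Ideal.sum_mem _ fun i hi => ?_)
    rw [pow_two]
    exact Ideal.mul_mem_mul ((mem_maximalIdeal _).2 (h i hi)) (hsm i hi)
  let q := Ideal.Quotient.mk (Ideal.span {t})
  have hq : Function.Surjective q := Ideal.Quotient.mk_surjective
  have hqt : q t = 0 := Ideal.Quotient.eq_zero_iff_mem.2 (Ideal.mem_span_singleton_self t)
  set I : Ideal (A ⧸ Ideal.span {t}) := Ideal.span ((s.erase j).image q : Finset _)
  have hmem : ∀ i ∈ s, i ≠ j → q i ∈ I := fun i hi hij =>
    Ideal.subset_span (Finset.mem_coe.2 (Finset.mem_image_of_mem _ (Finset.mem_erase.2 ⟨hij, hi⟩)))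
  have hjI : q j ∈ I := by
    have h0 : q (a j) * q j = - ∑ i ∈ s.erase j, q (a i) * q i := by
      rw [eq_neg_iff_add_eq_zero, Finset.add_sum_erase s (fun i => q (a i) * q i) hj]
      simpa [hqt] using congr(q $ha)
    rw [← Ideal.unit_mul_mem_iff_mem I (haj.map q), h0]
    exact I.neg_mem (Ideal.sum_mem _ fun i hi => I.mul_mem_left _
      (hmem i (Finset.mem_of_mem_erase hi) (Finset.ne_of_mem_erase hi)))
  have key : maximalIdeal (A ⧸ Ideal.span {t}) = I := by
    refine le_antisymm (fun x hx => ?_) (Ideal.span_le.2 fun x hx => ?_)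
    · obtain ⟨x, rfl⟩ := hq x
      have hx' : x ∈ maximalIdeal A := by
        rw [mem_maximalIdeal, mem_nonunits_iff] at hx ⊢
        exact fun h => hx (h.map q)
      rw [← hspan] at hx'
      obtain ⟨b, -, rfl⟩ := Submodule.mem_span_finset.1 hx'
      rw [map_sum]
      refine Ideal.sum_mem _ fun i hi => ?_
      rw [smul_eq_mul, map_mul]
      refine I.mul_mem_left _ ?_
      by_cases hij : i = j
      · exact hij ▸ hjI
      · exact hmem i hi hij
    · obtain ⟨i, hi, rfl⟩ := Finset.mem_image.1 (Finset.mem_coe.1 hx)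
      have := hsm i (Finset.mem_of_mem_erase hi)
      have hl : IsLocalHom q := .of_surjective q hq
      exact ((mem_maximalIdeal _).2 fun h => (mem_maximalIdeal _).1 this (hl.map_nonunit _ h))
  rw [key, ← hs]
  refine lt_of_le_of_lt ((Submodule.spanFinrank_span_le_ncard_of_finite
    (Finset.finite_toSet _)).trans ?_) (Finset.card_erase_lt_of_mem hj)
  rw [Set.ncard_coe_finset]
  exact Finset.card_image_le

/-- The embedding dimension drops by at least one, the Krull dimension by at most one. -/
theorem quotient_span_singleton {A : Type*} [CommRing A] [IsRegularLocalRing A] {t : A}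
    (ht : t ∈ maximalIdeal A) (ht' : t ∉ maximalIdeal A ^ 2) :
    IsRegularLocalRing (A ⧸ Ideal.span {t}) := by
  have : Nontrivial (A ⧸ Ideal.span {t}) :=
    Ideal.Quotient.nontrivial_iff.2 fun h => (maximalIdeal.isMaximal A).ne_top
      (top_le_iff.1 (h ▸ (Ideal.span_singleton_le_iff_mem _).2 ht))
  have : IsLocalRing (A ⧸ Ideal.span {t}) :=
    .of_surjective' (Ideal.Quotient.mk _) Ideal.Quotient.mk_surjective
  refine of_spanFinrank_maximalIdeal_le _ ?_
  have h1 := spanFinrank_maximalIdeal_quotient_lt ht ht'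
  have h2 := ringKrullDim_le_ringKrullDim_quotient_add_card {t}
    (by simpa [ringJacobson_eq_maximalIdeal] using ht)
  rw [← spanFinrank_maximalIdeal, Finset.coe_singleton] at h2
  have h3 : ((maximalIdeal (A ⧸ Ideal.span {t})).spanFinrank : WithBot ℕ∞) + 1 ≤
      ringKrullDim (A ⧸ Ideal.span {t}) + 1 := by
    refine le_trans ?_ (h2.trans (by simp))
    exact_mod_cast Nat.succ_le_of_lt h1
  exact (WithBot.add_le_add_iff_right' (c := (1 : WithBot ℕ∞)) WithBot.coe_ne_bot
    (mt WithBot.coe_injective.eq_iff.1 ENat.one_ne_top)).1 h3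

theorem exists_mem_maximalIdeal_notMem_sq {A : Type*} [CommRing A] [IsLocalRing A]
    [IsNoetherianRing A] (h : ¬ IsField A) : ∃ t ∈ maximalIdeal A, t ∉ maximalIdeal A ^ 2 := by
  by_contra! H
  refine h (isField_iff_maximalIdeal_eq.2 ?_)
  refine Submodule.eq_bot_of_le_smul_of_le_jacobson_bot (maximalIdeal A) _
    (maximalIdeal A).fg_of_isNoetherianRing ?_ (maximalIdeal_le_jacobson _)
  rwa [smul_eq_mul, ← pow_two]

/-- A regular local ring is a domain. -/
theorem isDomain (A : Type*) [CommRing A] [IsRegularLocalRing A] : IsDomain A := by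
  induction h : (maximalIdeal A).spanFinrank using Nat.strong_induction_on generalizing A with
  | _ n ih =>
  by_cases hA : IsField A
  · exact hA.isDomain
  have hne : maximalIdeal A ≠ ⊥ := mt isField_iff_maximalIdeal_eq.2 hA
  have hdim : ringKrullDim A ≠ 0 := fun h0 => hne <| by
    rw [← spanFinrank_maximalIdeal] at h0
    exact (Submodule.spanFinrank_eq_zero_iff_eq_bot
      (maximalIdeal A).fg_of_isNoetherianRing).1 (by exact_mod_cast h0)
  obtain ⟨t, ht, ht2, htp⟩ : ∃ t ∈ maximalIdeal A, t ∉ maximalIdeal A ^ 2 ∧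
      ∀ p ∈ minimalPrimes A, t ∉ p := by
    by_contra! H
    -- Prime avoidance tolerates two ideals that are not prime; `maximalIdeal A ^ 2` takes both
    -- places.
    obtain ⟨i, hi, hle⟩ := (Ideal.subset_union_prime_finite (I := maximalIdeal A) (f := id)
      ((minimalPrimes.finite_of_isNoetherianRing A).insert (maximalIdeal A ^ 2))
      (maximalIdeal A ^ 2) (maximalIdeal A ^ 2)
      (fun i hi h _ => (Set.mem_of_mem_insert_of_ne hi h).1.1)).1 (fun t ht => by
        by_cases h2 : t ∈ maximalIdeal A ^ 2
        · exact Set.mem_biUnion (Set.mem_insert _ _) h2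
        · obtain ⟨p, hp, htp⟩ := H t ht h2
          exact Set.mem_biUnion (Set.mem_insert_of_mem _ hp) htp)
    rcases hi with rfl | hi
    · obtain ⟨t, ht, ht'⟩ := exists_mem_maximalIdeal_notMem_sq hA
      exact ht' (hle ht)
    · have : i.IsPrime := hi.1.1
      have him : maximalIdeal A = i := le_antisymm hle (le_maximalIdeal this.ne_top)
      refine hdim ?_
      rw [← maximalIdeal_height_eq_ringKrullDim, him]
      rw [Ideal.height_eq_zero_iff.2 hi]
      rfl
  have hreg := quotient_span_singleton ht ht2
  have hdom := ih _ (h ▸ spanFinrank_maximalIdeal_quotient_lt ht ht2) (A ⧸ Ideal.span {t}) rfl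
  have hprime : (Ideal.span {t}).IsPrime := (Ideal.Quotient.isDomain_iff_prime _).1 hdom
  obtain ⟨p, hp, hpt⟩ := Ideal.exists_minimalPrimes_le (bot_le : ⊥ ≤ Ideal.span {t})
  have hpp : p.IsPrime := hp.1.1
  -- An element of `p` is `t * a` with `t ∉ p`, so `a ∈ p`. Hence `p` is contained in `maximalIdeal
  -- A * p`, and Nakayama applies.
  have hp0 : p = ⊥ := by
    refine Submodule.eq_bot_of_le_smul_of_le_jacobson_bot (maximalIdeal A) _
      p.fg_of_isNoetherianRing (fun y hy => ?_) (maximalIdeal_le_jacobson _)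
    obtain ⟨a, rfl⟩ := Ideal.mem_span_singleton.1 (hpt hy)
    exact Ideal.mul_mem_mul ht ((hpp.mem_or_mem hy).resolve_left (htp p hp))
  have : (⊥ : Ideal A).IsPrime := hp0 ▸ hpp
  exact IsDomain.of_bot_isPrime A

end IsRegularLocalRing

/-! ### Algebraic extensions inside fraction fields -/

/-- The elements algebraic over a field of the fraction field of an integrally closed algebra
over it lie in that algebra. -/
theorem exists_algHom_of_isIntegrallyClosed {k V L E : Type*} [Field k] [CommRing V] [IsDomain V]
    [IsIntegrallyClosed V]
    [Field L] [Field E] [Algebra k V] [Algebra V L] [Algebra k L] [IsScalarTower k V L]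
    [IsFractionRing V L] [Algebra k E] [Algebra.IsAlgebraic k E] (φ : E →ₐ[k] L) :
    Nonempty (E →ₐ[k] V) := by
  let ψ := IsScalarTower.toAlgHom k V L
  have hψ : Function.Injective ψ := IsFractionRing.injective V L
  have h : ∀ e, φ e ∈ ψ.range := fun e => by
    have : IsIntegral V (φ e) :=
      ((Algebra.IsIntegral.isIntegral (R := k) e).map φ).tower_top
    obtain ⟨y, hy⟩ := IsIntegrallyClosed.algebraMap_eq_of_integral this
    exact ⟨y, hy⟩
  exact ⟨(AlgEquiv.ofInjective ψ hψ).symm.toAlgHom.comp (φ.codRestrict ψ.range h)⟩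

/-- An algebraic extension of `k` that embeds into the fraction field of a regular local
`k`-algebra embeds into every field receiving a local homomorphism from that algebra. -/
theorem IsRegularLocalRing.exists_algHom_of_isFractionRing {k : Type*} [Field k] {E : Type*}
    [Field E]
    [Algebra k E] [Algebra.IsAlgebraic k E] {F : Type*} [Field F] [Algebra k F]
    {B : Type u} [CommRing B] [IsRegularLocalRing B] [Algebra k B]
    (L : Type u) [Field L] [Algebra B L] [IsFractionRing B L] [Algebra k L] [IsScalarTower k B L]
    (φ : E →ₐ[k] L) (χ : B →ₐ[k] F) (hχ : IsLocalHom χ) :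
    Nonempty (E →ₐ[k] F) := by
  induction h : (maximalIdeal B).spanFinrank using Nat.strong_induction_on generalizing B L with
  | _ n ih =>
  have := IsRegularLocalRing.isDomain B
  by_cases hB : IsField B
  · let := hB.toField
    exact (exists_algHom_of_isIntegrallyClosed (V := B) φ).map χ.comp
  obtain ⟨t, ht, ht2⟩ := exists_mem_maximalIdeal_notMem_sq hB
  have hreg := quotient_span_singleton ht ht2
  have hdom := isDomain (B ⧸ Ideal.span {t})
  have hprime : (Ideal.span {t}).IsPrime := (Ideal.Quotient.isDomain_iff_prime _).1 hdom
  let P := Ideal.span {t}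
  -- `V` is a valuation ring, hence integrally closed, so `E` embeds in it without normality of `B`
  -- being needed. Its residue field is the fraction field of `B ⧸ P`, to which induction applies.
  let V := Localization.AtPrime P
  have : (maximalIdeal V).IsPrincipal := by
    rw [← Localization.AtPrime.map_eq_maximalIdeal, Ideal.map_span, Set.image_singleton]
    exact ⟨_, rfl⟩
  have : ValuationRing V := ((tfae_of_isNoetherianRing_of_isLocalRing_of_isDomain V).out 4 1).1 this
  have hle : P.primeCompl ≤ nonZeroDivisors B := P.primeCompl_le_nonZeroDivisors
  let := IsLocalization.localizationAlgebraOfSubmonoidLe V L _ _ hle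
  have : IsScalarTower B V L := IsLocalization.localization_isScalarTower_of_submonoid_le ..
  have : IsFractionRing V L := IsFractionRing.isFractionRing_of_isDomain_of_isLocalization
    P.primeCompl V L
  have : IsScalarTower k V L := .of_algebraMap_eq fun x => by
    rw [IsScalarTower.algebraMap_apply k B V, ← IsScalarTower.algebraMap_apply B V L,
      ← IsScalarTower.algebraMap_apply k B L]
  obtain ⟨φ'⟩ := exists_algHom_of_isIntegrallyClosed (V := V) φ
  let ρ : V →ₐ[k] P.ResidueField := IsScalarTower.toAlgHom k V _
  refine ih _ (h ▸ spanFinrank_maximalIdeal_quotient_lt ht ht2) (B := B ⧸ P) P.ResidueField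
    (ρ.comp φ') (Ideal.Quotient.liftₐ P χ fun x hx => ?_) ?_ rfl
  · have hxm : x ∈ maximalIdeal B :=
      (Ideal.span_singleton_le_iff_mem _).2 ht hx
    by_contra hne
    exact (mem_maximalIdeal _).1 hxm (hχ.map_nonunit x (isUnit_iff_ne_zero.2 hne))
  · refine ⟨fun x hx => ?_⟩
    obtain ⟨x, rfl⟩ := Ideal.Quotient.mk_surjective x
    exact (hχ.map_nonunit x hx).map _

/-! ### Finiteness of the field of constants -/

open TensorProduct in
-- In the Noetherian ring `L ⊗[k] L`, finitely many `e ⊗ 1 - 1 ⊗ e` generate the ideal of all of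
-- them with `e ∈ E`. Over the field `E₀` generated by these finitely many `e` they all vanish, and
-- faithfully flat descent puts `E` inside `E₀`.
theorem IntermediateField.fg_of_essFiniteType {k L : Type*} [Field k] [Field L] [Algebra k L]
    [Algebra.EssFiniteType k L] (E : IntermediateField k L) : E.FG := by
  classical
  have : IsNoetherianRing (L ⊗[k] L) := Algebra.EssFiniteType.isNoetherianRing L _
  let d : L → L ⊗[k] L := fun e => e ⊗ₜ 1 - 1 ⊗ₜ e
  obtain ⟨s, hs, hspan⟩ := Submodule.fg_span_iff_fg_span_finset_subset (d '' E) |>.1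
    (IsNoetherian.noetherian (Ideal.span (d '' E)))
  obtain ⟨r, hr, rfl⟩ := Finset.subset_set_image_iff.1 hs
  refine ⟨r, le_antisymm (adjoin_le_iff.2 hr) fun e he => ?_⟩
  let E₀ := adjoin k (r : Set L)
  let g : L ⊗[k] L →ₐ[k] L ⊗[E₀] L := Algebra.TensorProduct.lift
    ((Algebra.TensorProduct.includeLeft : L →ₐ[E₀] L ⊗[E₀] L).restrictScalars k)
    ((Algebra.TensorProduct.includeRight : L →ₐ[E₀] L ⊗[E₀] L).restrictScalars k)
    fun _ _ => .all _ _
  have hgd (x : L) : g (d x) = x ⊗ₜ 1 - 1 ⊗ₜ x := by simp [g, d]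
  have hle : Ideal.span (d '' E) ≤ RingHom.ker g := by
    refine hspan.trans_le (Ideal.span_le.2 fun y hy => ?_)
    obtain ⟨x, hx, rfl⟩ := Finset.mem_image.1 (Finset.mem_coe.1 hy)
    have := Algebra.TensorProduct.tmul_one_eq_one_tmul (A := L) (B := L)
      (⟨x, subset_adjoin k _ hx⟩ : E₀)
    exact (hgd x).trans (sub_eq_zero.2 this)
  have he' : e ∈ Set.range (algebraMap E₀ L) := by
    rw [← (Algebra.IsEffective.of_faithfullyFlat E₀ L).eqLocus_includeLeft_includeRight]
    exact sub_eq_zero.1 ((hgd e).symm.trans (hle (Ideal.subset_span ⟨e, he, rfl⟩)))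
  obtain ⟨x, rfl⟩ := he'
  exact x.2

theorem finiteDimensional_algebraicClosure_of_essFiniteType (k L : Type*) [Field k] [Field L]
    [Algebra k L] [Algebra.EssFiniteType k L] : FiniteDimensional k (algebraicClosure k L) := by
  have := IntermediateField.essFiniteType_iff.2 (algebraicClosure k L).fg_of_essFiniteType
  exact Algebra.finite_of_essFiniteType_of_isAlgebraic

/-! ### Stalks, residue fields and the special fibre -/

/-- If `η` specializes to `y`, the maximal ideal of the local ring at `η` is generated by the
corresponding prime ideal of the local ring at `y`. -/
theorem AlgebraicGeometry.Scheme.maximalIdeal_stalk_le_map_stalkSpecializes {Y : Scheme.{u}}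
    {η y : Y} (h : η ⤳ y) :
    maximalIdeal (Y.presheaf.stalk η) ≤
      ((maximalIdeal (Y.presheaf.stalk η)).comap (Y.presheaf.stalkSpecializes h).hom).map
        (Y.presheaf.stalkSpecializes h).hom := by
  obtain ⟨_, ⟨U, hU, rfl⟩, hyU, -⟩ :=
    Y.isBasis_affineOpens.exists_subset_of_mem_open (Set.mem_univ y) isOpen_univ
  have hηU : η ∈ U := h.mem_open U.2 hyU
  let : Algebra Γ(Y, U) (Y.presheaf.stalk η) := (Y.presheaf.germ U η hηU).hom.toAlgebra
  have : IsLocalization.AtPrime (Y.presheaf.stalk η) (hU.primeIdealOf ⟨η, hηU⟩).asIdeal :=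
    hU.isLocalization_stalk ⟨η, hηU⟩
  rw [← IsLocalization.AtPrime.map_eq_maximalIdeal (hU.primeIdealOf ⟨η, hηU⟩).asIdeal
    (Y.presheaf.stalk η), Ideal.map_le_iff_le_comap]
  intro a ha
  have hfac : algebraMap Γ(Y, U) (Y.presheaf.stalk η) a =
      Y.presheaf.stalkSpecializes h (Y.presheaf.germ U y hyU a) :=
    (TopCat.Presheaf.germ_stalkSpecializes_apply Y.presheaf hyU h a).symm
  have hmem := Ideal.mem_map_of_mem (algebraMap Γ(Y, U) (Y.presheaf.stalk η)) ha
  rw [Ideal.mem_comap, hfac]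
  rw [hfac] at hmem
  exact Ideal.mem_map_of_mem _ (Ideal.mem_comap.2 hmem)

theorem AlgebraicGeometry.Spec.essFiniteType_germ_top (A : CommRingCat.{u}) (x : Spec A) :
    ((Scheme.ΓSpecIso A).inv ≫ (Spec A).presheaf.germ ⊤ x trivial).hom.EssFiniteType := by
  have : x.asIdeal.IsPrime := PrimeSpectrum.isPrime x
  refine congr(RingHom.EssFiniteType $(Spec.algebraMap_stalkIso_inv (R := A) x).hom).mp ?_
  exact (RingHom.essFiniteType_algebraMap.2 (.of_isLocalization _ x.asIdeal.primeCompl)).comp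
    (RingHom.FiniteType.of_surjective _
      (Spec.stalkIso A x).commRingCatIsoToRingEquiv.symm.surjective).essFiniteType

namespace DVRScheme

section

variable {R : Type u} [CommRing R] {X : Scheme.{u}} (f : X ⟶ Spec (.of R))

theorem fromSpecStalk_comp (x : X) :
    X.fromSpecStalk x ≫ f = Spec.map (CommRingCat.ofHom (toStalk f x)) := by
  rw [toStalk, CommRingCat.ofHom_hom, Spec.map_comp, Spec.map_comp, ← Scheme.fromSpecStalk_toSpecΓ,
    Category.assoc, Category.assoc, ← Scheme.toSpecΓ_naturality_assoc,
    toSpecΓ_SpecMap_ΓSpecIso_inv, Category.comp_id]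

/-- Reduces compatibility of ring maps with `R` to an identity of morphisms of schemes. -/
theorem comp_toStalk_eq {A : CommRingCat.{u}} {x : X} (φ : X.presheaf.stalk x ⟶ A) (ψ : R →+* A)
    (h : Spec.map φ ≫ X.fromSpecStalk x ≫ f = Spec.map (CommRingCat.ofHom ψ)) :
    φ.hom.comp (toStalk f x) = ψ := by
  rw [fromSpecStalk_comp, ← Spec.map_comp] at h
  exact congr(($(Spec.map_injective h)).hom)

theorem apply_eq_comap_closedPoint (x : X) :
    f x = Spec.map (CommRingCat.ofHom (toStalk f x)) (closedPoint (X.presheaf.stalk x)) := by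
  rw [← fromSpecStalk_comp]
  exact congr(f $(Scheme.fromSpecStalk_closedPoint (x := x))).symm

end

section SpecialFibre

variable {R : Type u} [CommRing R] [IsLocalRing R] {X : Scheme.{u}} (f : X ⟶ Spec (.of R))

instance : IsClosedImmersion (Spec.map (CommRingCat.ofHom (residue R))) :=
  IsClosedImmersion.spec_of_surjective _ residue_surjective

/-- The structure map `κ → κ(z)` for a point `z` of `X_κ`. -/
noncomputable def residueFieldStructure (z : specialFibre f) :
    CommRingCat.of (ResidueField R) ⟶ (specialFibre f).residueField z :=
  (Scheme.ΓSpecIso (.of (ResidueField R))).inv ≫ (specialFibreHom f).appTop ≫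
    (specialFibre f).Γevaluation z

theorem fromSpecResidueField_comp (z : specialFibre f) :
    (specialFibre f).fromSpecResidueField z ≫ specialFibreHom f =
      Spec.map (residueFieldStructure f z) := by
  rw [Scheme.fromSpecResidueField, Category.assoc, fromSpecStalk_comp, ← Spec.map_comp]
  rfl

theorem apply_specialFibreι (z : specialFibre f) : f (specialFibreι f z) = closedPoint R := by
  rw [← Scheme.Hom.comp_apply, pullback.condition, Scheme.Hom.comp_apply]
  exact PrimeSpectrum.comap_residue R _

theorem isLocalHom_toStalk_specialFibreι (z : specialFibre f) :
    IsLocalHom (toStalk f (specialFibreι f z)) := by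
  have h := apply_eq_comap_closedPoint f (specialFibreι f z)
  rw [apply_specialFibreι] at h
  exact ((local_hom_TFAE (toStalk f (specialFibreι f z))).out 0 4).2 congr(($h.symm).asIdeal)

/-- The composite `R → 𝒪_{X,z} → κ(z)` is the composite of the residue map of `R` and `κ → κ(z)`. -/
theorem residue_comp_stalkMap_comp_toStalk (z : specialFibre f) :
    ((specialFibreι f).stalkMap z ≫ (specialFibre f).residue z).hom.comp
        (toStalk f (specialFibreι f z)) = (residueFieldStructure f z).hom.comp (residue R) := by
  apply comp_toStalk_eq
  rw [Spec.map_comp, Category.assoc, Scheme.SpecMap_stalkMap_fromSpecStalk_assoc,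
    pullback.condition, ← Category.assoc]
  change (specialFibre f).fromSpecResidueField _ ≫ specialFibreHom f ≫ _ = _
  rw [reassoc_of% fromSpecResidueField_comp f z, ← Spec.map_comp]
  rfl

theorem componentMultiplicity_eq_one_iff (C : irreducibleComponents (specialFibre f)) :
    componentMultiplicity f C = 1 ↔ maximalIdeal (componentLocalRing f C) =
      (maximalIdeal R).map (toStalk f (specialFibreι f (componentPoint f C))) := by
  rw [componentMultiplicity, Module.length_eq_one_iff, isSimpleModule_iff_isCoatom,
    ← Ideal.isMaximal_def]
  exact ⟨fun h => (eq_maximalIdeal h).symm, fun h => h ▸ maximalIdeal.isMaximal _⟩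

theorem essFiniteType_residueFieldStructure [LocallyOfFiniteType f] (z : specialFibre f) :
    (residueFieldStructure f z).hom.EssFiniteType := by
  have h : residueFieldStructure f z =
      ((Scheme.ΓSpecIso _).inv ≫ (Spec (.of (ResidueField R))).presheaf.germ ⊤ _ trivial) ≫
        (specialFibreHom f).stalkMap z ≫ (specialFibre f).residue z := by
    have := Scheme.Hom.germ_stalkMap_assoc (specialFibreHom f) ⊤ z trivial
      ((specialFibre f).residue z)
    exact congr((Scheme.ΓSpecIso (.of (ResidueField R))).inv ≫ $this).symm
  rw [h]
  exact (AlgebraicGeometry.Spec.essFiniteType_germ_top _ _).comp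
    ((LocallyOfFiniteType.stalkMap (specialFibreHom f) z).comp
      (RingHom.FiniteType.of_surjective _ ((specialFibre f).residue_surjective z)).essFiniteType)

instance (C : irreducibleComponents (specialFibre f)) [LocallyOfFiniteType f] :
    Algebra.EssFiniteType (ResidueField R) (componentFunctionField f C) :=
  essFiniteType_residueFieldStructure f (componentPoint f C)

end SpecialFibre

end DVRScheme

/-! ### The component of the special fibre through a point where `ϖ` is a parameter -/

namespace DVRScheme

section SpecialFibre

variable {R : Type u} [CommRing R] [IsLocalRing R] {X : Scheme.{u}} (f : X ⟶ Spec (.of R))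

theorem componentPoint_eq {C : irreducibleComponents (specialFibre f)} {z : specialFibre f}
    (h : (C : Set (specialFibre f)) = closure {z}) : componentPoint f C = z := by
  refine IsGenericPoint.eq (C.2.1.isGenericPoint_genericPoint_closure) ?_
  rw [h, closure_closure]
  exact isGenericPoint_closure

/-- If the image of `𝔪` in the local ring of `X` at `y` generates the prime ideal `p`, and `z` is
the point of `X_κ` given by `p`, then the closure of `z` is a component of `X_κ`. -/
theorem closure_mem_irreducibleComponents {y : X} {p : Spec (X.presheaf.stalk y)}
    (hp : PrimeSpectrum.asIdeal p ≤ (maximalIdeal R).map (toStalk f y)) {z : specialFibre f}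
    (hz : specialFibreι f z = X.fromSpecStalk y p) :
    closure {z} ∈ irreducibleComponents (specialFibre f) := by
  refine ⟨isIrreducible_singleton.closure, fun T hT hle => ?_⟩
  have ht := hT.isGenericPoint_genericPoint_closure
  set t := hT.genericPoint
  have htz : t ⤳ z := ht.specializes (subset_closure (hle (subset_closure rfl)))
  have hι : specialFibreι f t ⤳ specialFibreι f z := htz.map (specialFibreι f).continuous
  have hzy : specialFibreι f z ⤳ y := by
    have : specialFibreι f z ∈ Set.range (X.fromSpecStalk y) := ⟨_, hz.symm⟩
    rwa [Scheme.range_fromSpecStalk] at this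
  obtain ⟨q, hq⟩ : specialFibreι f t ∈ Set.range (X.fromSpecStalk y) := by
    rw [Scheme.range_fromSpecStalk]
    exact hι.trans hzy
  rw [← hq, hz, (X.fromSpecStalk y).isEmbedding.specializes_iff] at hι
  have hqp : q.asIdeal ≤ p.asIdeal := (PrimeSpectrum.le_iff_specializes q p).2 hι
  -- The point given by `q` lies in the special fibre, so `q` contains the image of `𝔪`, which
  -- contains `p`.
  have hmq : (maximalIdeal R).map (toStalk f y) ≤ q.asIdeal := by
    have h1 : f (X.fromSpecStalk y q) = closedPoint R := by rw [hq, apply_specialFibreι]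
    rw [← Scheme.Hom.comp_apply, fromSpecStalk_comp] at h1
    rw [Ideal.map_le_iff_le_comap]
    exact congr(($h1).asIdeal).ge
  have hqe : q = p := PrimeSpectrum.ext (le_antisymm hqp (hp.trans hmq))
  have htz' : t = z := (specialFibreι f).isClosedEmbedding.injective (by rw [← hq, hz, hqe])
  exact subset_closure.trans (htz' ▸ ht.def.ge)

/-- The maximal ideal at `z` is generated by `p`, hence by `𝔪`; this yields multiplicity one. -/
theorem maximalIdeal_stalk_eq_map {y : X} {p : Spec (X.presheaf.stalk y)}
    (hp : PrimeSpectrum.asIdeal p ≤ (maximalIdeal R).map (toStalk f y)) {z : specialFibre f}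
    (hz : specialFibreι f z = X.fromSpecStalk y p) :
    maximalIdeal (X.presheaf.stalk (specialFibreι f z)) =
      (maximalIdeal R).map (toStalk f (specialFibreι f z)) := by
  have hzy : specialFibreι f z ⤳ y := by
    have : specialFibreι f z ∈ Set.range (X.fromSpecStalk y) := ⟨_, hz.symm⟩
    rwa [Scheme.range_fromSpecStalk] at this
  have := isLocalHom_toStalk_specialFibreι f z
  refine le_antisymm ?_ (map_maximalIdeal_le _)
  have hcomap : (maximalIdeal (X.presheaf.stalk (specialFibreι f z))).comap
      (X.presheaf.stalkSpecializes hzy).hom = p.asIdeal := by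
    have h1 : X.fromSpecStalk y (Spec.map (X.presheaf.stalkSpecializes hzy)
        (closedPoint (X.presheaf.stalk (specialFibreι f z)))) = X.fromSpecStalk y p :=
      congr($(Scheme.SpecMap_stalkSpecializes_fromSpecStalk hzy) (closedPoint _)).trans
        (Scheme.fromSpecStalk_closedPoint.trans hz)
    exact congr(($((X.fromSpecStalk y).isEmbedding.injective h1)).asIdeal)
  have hcomp : (X.presheaf.stalkSpecializes hzy).hom.comp (toStalk f y) =
      toStalk f (specialFibreι f z) := by
    apply comp_toStalk_eq
    rw [Scheme.SpecMap_stalkSpecializes_fromSpecStalk_assoc, fromSpecStalk_comp]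
  refine (Scheme.maximalIdeal_stalk_le_map_stalkSpecializes hzy).trans ?_
  rw [hcomap, ← hcomp, ← Ideal.map_map]
  exact Ideal.map_mono hp

end SpecialFibre

section

variable {R : Type u} [CommRing R] [IsDomain R] [IsDiscreteValuationRing R]
  {X : Scheme.{u}} (f : X ⟶ Spec (.of R))

theorem exists_multOneComponent_of_notMem_sq {y : X} [IsRegularLocalRing (X.presheaf.stalk y)]
    {ϖ : R} (hϖ : Irreducible ϖ) (hmem : toStalk f y ϖ ∈ maximalIdeal (X.presheaf.stalk y))
    (hsq : toStalk f y ϖ ∉ maximalIdeal (X.presheaf.stalk y) ^ 2) :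
    ∃ D : MultOneComponent f, ∀ (F : Type u) [Field F] [Algebra (ResidueField R) F]
      (χ : X.presheaf.stalk y →+* F), IsLocalHom χ →
      χ.comp (toStalk f y) = (algebraMap (ResidueField R) F).comp (residue R) →
      Nonempty (D.constantField →ₐ[ResidueField R] F) := by
  let P := Ideal.span {toStalk f y ϖ}
  have hP : P = (maximalIdeal R).map (toStalk f y) := by
    rw [hϖ.maximalIdeal_eq, Ideal.map_span, Set.image_singleton]
  have hreg : IsRegularLocalRing (X.presheaf.stalk y ⧸ P) :=
    IsRegularLocalRing.quotient_span_singleton hmem hsq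
  have hdom := IsRegularLocalRing.isDomain (X.presheaf.stalk y ⧸ P)
  have hprime : P.IsPrime := (Ideal.Quotient.isDomain_iff_prime _).1 hdom
  have hPm : P ≤ maximalIdeal _ := (Ideal.span_singleton_le_iff_mem _).2 hmem
  let α : ResidueField R →+* X.presheaf.stalk y ⧸ P :=
    Ideal.Quotient.lift (maximalIdeal R) ((Ideal.Quotient.mk P).comp (toStalk f y)) fun a ha =>
      Ideal.Quotient.eq_zero_iff_mem.2 (hP ▸ Ideal.mem_map_of_mem _ ha)
  let := α.toAlgebra
  let L := P.ResidueField
  let β : X.presheaf.stalk y →+* L :=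
    (algebraMap (X.presheaf.stalk y ⧸ P) L).comp (Ideal.Quotient.mk P)
  let := ((algebraMap (X.presheaf.stalk y ⧸ P) L).comp α).toAlgebra
  have : IsScalarTower (ResidueField R) (X.presheaf.stalk y ⧸ P) L := .of_algebraMap_eq' rfl
  let q : Spec (.of L) ⟶ X := Spec.map (CommRingCat.ofHom β) ≫ X.fromSpecStalk y
  have hq : q ≫ f = Spec.map (CommRingCat.ofHom (algebraMap (ResidueField R) L)) ≫
      Spec.map (CommRingCat.ofHom (residue R)) := by
    rw [Category.assoc, fromSpecStalk_comp, ← Spec.map_comp, ← Spec.map_comp]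
    rfl
  let q' : Spec (.of L) ⟶ specialFibre f := pullback.lift q _ hq
  obtain ⟨z, hz⟩ : ∃ z, q' (closedPoint L) = z := ⟨_, rfl⟩
  let p : Spec (X.presheaf.stalk y) := (⟨P, hprime⟩ : PrimeSpectrum (X.presheaf.stalk y))
  have hzp : specialFibreι f z = X.fromSpecStalk y p := by
    have hβ : Spec.map (CommRingCat.ofHom β) (closedPoint L) = p := by
      refine PrimeSpectrum.ext ?_
      change (maximalIdeal L).comap β = P
      rw [maximalIdeal_eq_bot]
      exact P.ker_algebraMap_residueField
    rw [← hz, ← hβ]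
    exact congr($(pullback.lift_fst q _ hq) (closedPoint L))
  let C : irreducibleComponents (specialFibre f) :=
    ⟨_, closure_mem_irreducibleComponents f hP.le hzp⟩
  have hC : componentPoint f C = z := componentPoint_eq f rfl
  refine ⟨⟨C, (componentMultiplicity_eq_one_iff f C).2
    (maximalIdeal_stalk_eq_map f hP.le (hC ▸ hzp))⟩, ?_⟩
  -- A map from the function field of `C` to `L` is enough; that it is an isomorphism plays no role.
  let θ : (specialFibre f).residueField (componentPoint f C) ⟶ .of L :=
    ((specialFibre f).residueFieldCongr (hC.trans hz.symm)).hom ≫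
      Scheme.descResidueField (Scheme.stalkClosedPointTo q')
  have hθ : Spec.map θ ≫ (specialFibre f).fromSpecResidueField _ = q' := by
    rw [Spec.map_comp, Category.assoc, Scheme.residueFieldCongr_fromSpecResidueField]
    exact Scheme.descResidueField_stalkClosedPointTo_fromSpecResidueField L _ q'
  have hθ' : residueFieldStructure f (componentPoint f C) ≫ θ =
      CommRingCat.ofHom (algebraMap (ResidueField R) L) := by
    apply Spec.map_injective
    rw [Spec.map_comp, ← fromSpecResidueField_comp, reassoc_of% hθ]
    exact pullback.lift_snd _ _ _
  let θₐ : componentFunctionField f C →ₐ[ResidueField R] L :=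
    { θ.hom with commutes' := fun r => congr($(hθ').hom r) }
  intro F _ _ χ hχ hcomp
  let χ' : (X.presheaf.stalk y ⧸ P) →+* F := Ideal.Quotient.lift P χ fun a ha => by
    exact by_contra fun h =>
      (mem_maximalIdeal _).1 (hPm ha) (hχ.map_nonunit a (isUnit_iff_ne_zero.2 h))
  have hχ' (r : ResidueField R) : χ' (α r) = algebraMap (ResidueField R) F r := by
    obtain ⟨r, rfl⟩ := residue_surjective r
    exact congr($hcomp r)
  let χₐ : (X.presheaf.stalk y ⧸ P) →ₐ[ResidueField R] F := { χ' with commutes' := hχ' }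
  have hχₐ : IsLocalHom χₐ := ⟨fun x hx => by
    obtain ⟨x, rfl⟩ := Ideal.Quotient.mk_surjective x
    exact (hχ.map_nonunit x hx).map _⟩
  exact IsRegularLocalRing.exists_algHom_of_isFractionRing (B := X.presheaf.stalk y ⧸ P) L
    (θₐ.comp (IntermediateField.val _)) χₐ hχₐ

end

end DVRScheme

/-! ### The generic fibre and the valuative criterion -/

/-- The inclusion of the generic point of the spectrum of a discrete valuation ring is an open
immersion. -/
theorem IsDiscreteValuationRing.isOpenImmersion_specMap_algebraMap {R : Type u} [CommRing R]
    [IsDomain R] [IsDiscreteValuationRing R] (K : Type u) [Field K] [Algebra R K]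
    [IsFractionRing R K] : IsOpenImmersion (Spec.map (CommRingCat.ofHom (algebraMap R K))) := by
  obtain ⟨ϖ, hϖ⟩ := IsDiscreteValuationRing.exists_irreducible R
  have hle : Submonoid.powers ϖ ≤ nonZeroDivisors R :=
    powers_le_nonZeroDivisors_of_noZeroDivisors hϖ.ne_zero
  -- Every nonzero element is associated to a power of `ϖ`, so inverting `ϖ` inverts them all.
  have : IsFractionRing R (Localization.Away ϖ) :=
    IsLocalization.of_le_of_exists_dvd (Submonoid.powers ϖ) _ hle fun n hn => by
      obtain ⟨k, hk⟩ := IsDiscreteValuationRing.associated_pow_irreducible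
        (nonZeroDivisors.ne_zero hn) hϖ
      exact ⟨ϖ ^ k, ⟨k, rfl⟩, hk.dvd⟩
  let e : Localization.Away ϖ ≃ₐ[R] K :=
    IsLocalization.algEquiv (nonZeroDivisors R) (Localization.Away ϖ) K
  have he : Spec.map (CommRingCat.ofHom (algebraMap R K)) =
      Spec.map e.toRingEquiv.toCommRingCatIso.hom ≫
        Spec.map (CommRingCat.ofHom (algebraMap R (Localization.Away ϖ))) := by
    rw [← Spec.map_comp]
    congr 1
    ext r
    exact (e.commutes r).symm
  rw [he]
  have := Scheme.isOpenImmersion_SpecMap_localizationAway (R := .of R) ϖ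
  exact IsOpenImmersion.comp _ _

/-- If a local homomorphism maps `a` to a generator of the maximal ideal of a domain that is not a
field, then `a` is part of a minimal system of generators of the maximal ideal. -/
theorem IsLocalRing.notMem_maximalIdeal_sq_of_isLocalHom {A O : Type*} [CommRing A]
    [IsLocalRing A] [CommRing O] [IsLocalRing O] [IsDomain O] (φ : A →+* O) [IsLocalHom φ] {a : A} (ha : φ a ≠ 0)
    (hO : maximalIdeal O = Ideal.span {φ a}) : a ∉ maximalIdeal A ^ 2 := by
  intro h
  have h1 : φ a ∈ maximalIdeal O ^ 2 := by
    have := Ideal.mem_map_of_mem φ h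
    rw [Ideal.map_pow] at this
    exact Ideal.pow_right_mono (map_maximalIdeal_le φ) 2 this
  rw [hO, Ideal.span_singleton_pow, Ideal.mem_span_singleton] at h1
  obtain ⟨c, hc⟩ := h1
  have hu : φ a * c = 1 := mul_left_cancel₀ ha (by rw [mul_one, ← mul_assoc, ← pow_two, ← hc])
  have : φ a ∈ maximalIdeal O := hO ▸ Ideal.mem_span_singleton_self _
  exact (mem_maximalIdeal _).1 this (IsUnit.of_mul_eq_one _ hu)

namespace DVRScheme

/-- The valuative criterion for the local ring of `X` at a point where it is a valuation ring. -/
theorem exists_isLocalHom_stalk {R : Type u} [CommRing R] {X Y : Scheme.{u}}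
    (f : X ⟶ Spec (.of R)) (g : Y ⟶ Spec (.of R)) [IsIntegral X] [IsProper g] (x : X)
    [ValuationRing (X.presheaf.stalk x)]
    (hXY : ∃ h : Spec X.functionField ⟶ Y, h ≫ g = X.fromSpecStalk (genericPoint X) ≫ f) :
    ∃ (y : Y) (φ : Y.presheaf.stalk y →+* X.presheaf.stalk x), IsLocalHom φ ∧
      φ.comp (toStalk g y) = toStalk f x := by
  obtain ⟨h, hh⟩ := hXY
  have hval : ValuativeCriterion g := by
    have : IsProper g := inferInstance
    rw [IsProper.eq_valuativeCriterion] at this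
    exact this.1.1.1
  have hsq : CommSq h (Spec.map (CommRingCat.ofHom
      (algebraMap (X.presheaf.stalk x) X.functionField))) g
      (Spec.map (CommRingCat.ofHom (toStalk f x))) := ⟨by
    rw [hh, ← fromSpecStalk_comp, ← Category.assoc]
    congr 1
    exact (Scheme.SpecMap_stalkSpecializes_fromSpecStalk (genericPoint_specializes x)).symm⟩
  obtain ⟨⟨l, -, hl⟩⟩ :=
    (hval.existence ⟨X.presheaf.stalk x, X.functionField, h, _, hsq⟩).exists_lift
  refine ⟨l (closedPoint _), (Scheme.stalkClosedPointTo l).hom, inferInstance, ?_⟩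
  apply comp_toStalk_eq
  rw [Scheme.Spec_stalkClosedPointTo_fromSpecStalk_assoc]
  exact hl

variable {R : Type u} [CommRing R] [IsDomain R] [IsDiscreteValuationRing R]

section GenericFibre

variable (K : Type u) [Field K] [Algebra R K] [IsFractionRing R K]
  {X Y : Scheme.{u}} (f : X ⟶ Spec (.of R)) (g : Y ⟶ Spec (.of R))

instance isOpenImmersion_genericFibre_fst :
    IsOpenImmersion (pullback.fst f (Spec.map (CommRingCat.ofHom (algebraMap R K)))) :=
  have := IsDiscreteValuationRing.isOpenImmersion_specMap_algebraMap (R := R) K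
  inferInstance

/-- The generic fibre is open and non-empty, so it contains the generic point, which thus lies over
the zero ideal. -/
theorem toStalk_genericPoint_injective [IsIntegral X] (hX : Nonempty (genericFibre f K)) :
    Function.Injective (toStalk f (genericPoint X)) := by
  let j := pullback.fst f (Spec.map (CommRingCat.ofHom (algebraMap R K)))
  obtain ⟨w, hw⟩ : genericPoint X ∈ Set.range j := by
    obtain ⟨w⟩ := hX
    exact (genericPoint_specializes (j w)).mem_open j.isOpenEmbedding.isOpen_range ⟨w, rfl⟩
  have h1 : f (genericPoint X) = Spec.map (CommRingCat.ofHom (algebraMap R K))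
      (genericFibreHom f K w) := by
    rw [← hw, ← Scheme.Hom.comp_apply, pullback.condition, Scheme.Hom.comp_apply]
  rw [apply_eq_comap_closedPoint] at h1
  have h2 : (maximalIdeal X.functionField).comap (toStalk f (genericPoint X)) =
      (PrimeSpectrum.asIdeal (genericFibreHom f K w)).comap (algebraMap R K) :=
    congr(($h1).asIdeal)
  have h3 : PrimeSpectrum.asIdeal (genericFibreHom f K w) = ⊥ :=
    (Ideal.eq_bot_or_top _).resolve_right (PrimeSpectrum.isPrime _).ne_top
  rw [h3, maximalIdeal_eq_bot] at h2
  rw [RingHom.injective_iff_ker_eq_bot]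
  exact h2.trans ((RingHom.injective_iff_ker_eq_bot _).1 (IsFractionRing.injective R K))

/-- The domain of the birational map is a non-empty open subscheme of `X`, so `Spec` of the function
field factors through it. -/
theorem exists_functionField_hom [IsIntegral X] (hX : Nonempty (genericFibre f K))
    (hXY : Scheme.BirationalOver (genericFibreHom f K) (genericFibreHom g K)) :
    ∃ h : Spec X.functionField ⟶ Y, h ≫ g = X.fromSpecStalk (genericPoint X) ≫ f := by
  obtain ⟨e, he⟩ := hXY
  let j := e.source.ι ≫ pullback.fst f (Spec.map (CommRingCat.ofHom (algebraMap R K)))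
  have hne : Nonempty e.source := by
    obtain ⟨w, hw⟩ := e.dense_source.nonempty_iff.2 hX
    exact ⟨⟨w, hw⟩⟩
  have hgen : genericPoint X ∈ Set.range j := by
    obtain ⟨w⟩ := hne
    exact (genericPoint_specializes (j w)).mem_open j.isOpenEmbedding.isOpen_range ⟨w, rfl⟩
  have hrange : Set.range (X.fromSpecStalk (genericPoint X)) ⊆ Set.range j := by
    rw [Scheme.range_fromSpecStalk]
    exact fun x hx => Specializes.mem_open hx j.isOpenEmbedding.isOpen_range hgen
  have hj : j ≫ f = e.source.ι ≫ genericFibreHom f K ≫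
      Spec.map (CommRingCat.ofHom (algebraMap R K)) := by
    rw [Category.assoc, pullback.condition]
  refine ⟨IsOpenImmersion.lift j _ hrange ≫ e.iso.hom ≫ e.target.ι ≫ pullback.fst g _, ?_⟩
  rw [Category.assoc, Category.assoc, Category.assoc, pullback.condition,
    ← Category.assoc e.target.ι, ← Category.assoc e.iso.hom, he, Category.assoc, ← hj,
    IsOpenImmersion.lift_fac_assoc]

end GenericFibre

/-! ### Comparison of the components of two models -/

section

variable {X Y : Scheme.{u}} (f : X ⟶ Spec (.of R)) (g : Y ⟶ Spec (.of R))

theorem exists_multOneComponent_le [IsIntegral X] [IsRegularScheme X] [IsRegularScheme Y]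
    [IsProper g] (hinj : Function.Injective (toStalk f (genericPoint X)))
    (hXY : ∃ h : Spec X.functionField ⟶ Y, h ≫ g = X.fromSpecStalk (genericPoint X) ≫ f)
    (C : MultOneComponent f) :
    ∃ D : MultOneComponent g, Nonempty (D.constantField →ₐ[ResidueField R] C.constantField) := by
  obtain ⟨ϖ, hϖ⟩ := IsDiscreteValuationRing.exists_irreducible R
  set z := componentPoint f C.component
  set x := specialFibreι f z
  have hmax : maximalIdeal (X.presheaf.stalk x) = (maximalIdeal R).map (toStalk f x) :=
    (componentMultiplicity_eq_one_iff f C.component).1 C.multiplicity_eq_one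
  rw [hϖ.maximalIdeal_eq, Ideal.map_span, Set.image_singleton] at hmax
  have := IsRegularScheme.isRegularLocalRing_stalk x
  have : IsDomain (X.presheaf.stalk x) := IsRegularLocalRing.isDomain _
  have hprincipal : (maximalIdeal (X.presheaf.stalk x)).IsPrincipal := ⟨_, hmax⟩
  have hval : ValuationRing (X.presheaf.stalk x) :=
    ((tfae_of_isNoetherianRing_of_isLocalRing_of_isDomain _).out 4 1).1 hprincipal
  obtain ⟨y, φ, hφ, hcomp⟩ := exists_isLocalHom_stalk f g x hXY
  have := IsRegularScheme.isRegularLocalRing_stalk y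
  have hϖx : φ (toStalk g y ϖ) = toStalk f x ϖ := congr($hcomp ϖ)
  have hne : toStalk f x ϖ ≠ 0 := by
    intro h0
    have hsp : (X.presheaf.stalkSpecializes (genericPoint_specializes x)).hom.comp (toStalk f x) =
        toStalk f (genericPoint X) := by
      apply comp_toStalk_eq
      rw [Scheme.SpecMap_stalkSpecializes_fromSpecStalk_assoc, fromSpecStalk_comp]
    refine hϖ.ne_zero (hinj ?_)
    rw [← hsp, RingHom.comp_apply, h0, map_zero, map_zero]
  have hmem : toStalk g y ϖ ∈ maximalIdeal (Y.presheaf.stalk y) := by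
    rw [mem_maximalIdeal, mem_nonunits_iff, ← isUnit_map_iff φ, hϖx, ← mem_nonunits_iff,
      ← mem_maximalIdeal, hmax]
    exact Ideal.mem_span_singleton_self _
  obtain ⟨D, hD⟩ := exists_multOneComponent_of_notMem_sq g hϖ hmem
    (notMem_maximalIdeal_sq_of_isLocalHom φ (hϖx ▸ hne) (hϖx ▸ hmax))
  let χ := ((specialFibreι f).stalkMap z ≫ (specialFibre f).residue z).hom
  have hχ : IsLocalHom χ :=
    inferInstanceAs (IsLocalHom ((residue ((specialFibre f).presheaf.stalk z)).comp
      ((specialFibreι f).stalkMap z).hom))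
  have hχR : χ.comp (toStalk f x) = (residueFieldStructure f z).hom.comp (residue R) :=
    residue_comp_stalkMap_comp_toStalk f z
  obtain ⟨ψ⟩ := hD (componentFunctionField f C.component) (χ.comp φ) (RingHom.isLocalHom_comp χ φ)
    (by rw [← hcomp, ← RingHom.comp_assoc] at hχR; exact hχR)
  -- The image of `ψ` is algebraic over the residue field, so it lies in the field of constants of
  -- `C`.
  exact ⟨D, ⟨ψ.codRestrict C.constantField.toSubalgebra fun a =>
    mem_algebraicClosure_iff.2 ((Algebra.IsAlgebraic.isAlgebraic a).algHom ψ)⟩⟩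

/-- For minimal `C`, going to `D` below it and then back to `X` gives a component below `C`, hence
equivalent to `C`. So `C` and `D` embed in each other. -/
theorem minimalExtensions_subset
    (hfg : ∀ C : MultOneComponent f, ∃ D : MultOneComponent g,
      Nonempty (D.constantField →ₐ[ResidueField R] C.constantField))
    (hgf : ∀ D : MultOneComponent g, ∃ C : MultOneComponent f,
      Nonempty (C.constantField →ₐ[ResidueField R] D.constantField)) :
    minimalExtensions f ⊆ minimalExtensions g := by
  rintro E ⟨C, hC, rfl⟩
  obtain ⟨D, ⟨a⟩⟩ := hfg C
  have key : ∀ D' : MultOneComponent g, D' ≤ D →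
      Nonempty (C.constantField →ₐ[ResidueField R] D'.constantField) := by
    rintro D' ⟨d⟩
    obtain ⟨C', ⟨b⟩⟩ := hgf D'
    obtain ⟨c⟩ : C ≤ C' := hC ⟨(a.comp d).comp b⟩
    exact ⟨b.comp c⟩
  obtain ⟨b⟩ := key D le_rfl
  -- An endomorphism of an algebraic extension is bijective, so mutual embeddings are isomorphisms.
  have hab := Algebra.IsAlgebraic.algHom_bijective (a.comp b)
  have ha : Function.Bijective a := ⟨a.toRingHom.injective, .of_comp (g := b) hab.2⟩
  exact ⟨D, fun D' hD' => (key D' hD').map fun c => c.comp a,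
    Quotient.sound ⟨CommAlgCat.isoMk (AlgEquiv.ofBijective a ha).symm⟩⟩

end

end DVRScheme

theorem corollary2p3 {R : Type u} [CommRing R] [IsDomain R] [IsDiscreteValuationRing R]
    [PerfectField (IsLocalRing.ResidueField R)]
    (K : Type u) [Field K] [Algebra R K] [IsFractionRing R K]
    {X Y : Scheme.{u}} (f : X ⟶ Spec (.of R)) (g : Y ⟶ Spec (.of R))
    [IsProper f] [IsProper g] [IsIntegral X] [IsIntegral Y]
    [IsRegularScheme X] [IsRegularScheme Y]
    (hX : Nonempty (DVRScheme.genericFibre f K)) (hY : Nonempty (DVRScheme.genericFibre g K))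
    (hXY : Scheme.BirationalOver (DVRScheme.genericFibreHom f K)
      (DVRScheme.genericFibreHom g K)) :
    (∀ C : DVRScheme.MultOneComponent f, IsMin C →
      FiniteDimensional (IsLocalRing.ResidueField R) C.constantField) ∧
    DVRScheme.minimalExtensions f = DVRScheme.minimalExtensions g := by
  have hfg := DVRScheme.exists_multOneComponent_le f g
    (DVRScheme.toStalk_genericPoint_injective K f hX)
    (DVRScheme.exists_functionField_hom K f g hX hXY)
  have hgf := DVRScheme.exists_multOneComponent_le g f
    (DVRScheme.toStalk_genericPoint_injective K g hY)
    (DVRScheme.exists_functionField_hom K g f hY hXY.symm)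
  exact ⟨fun C _ => finiteDimensional_algebraicClosure_of_essFiniteType _ _,
    (DVRScheme.minimalExtensions_subset f g hfg hgf).antisymm
      (DVRScheme.minimalExtensions_subset g f hgf hfg)⟩
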